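/- Let $(M,g_M,J)$ be a Kähler manifold (that is, a Riemannian manifold with a smooth almost complex structure $J$, $J^2=-\mathrm{id}$, such that $g_M(JX,JY)=g_M(X,Y)$ and $\nabla J=0$, where $\nabla$ is the Levi-Civita connection of $g_M$), let $(N,g_N)$ be a Riemannian manifold, and let $F:M\to N$ be a Riemannian submersion onto $N$, i.e. a surjective $C^\infty$-submersion whose differential $F_*$ preserves the lengths of vectors in $(\ker F_*)^\perp$. Suppose that $F$ is a v-semi-slant submersion: there is a smooth distribution $\mathcal D_1\subset(\ker F_*)^\perp$ with $J(\mathcal D_1)=\mathcal D_1$ such that, if $\mathcal D_2$ denotes the orthogonal complement of $\mathcal D_1$ in $(\ker F_*)^\perp$, the angle between $JX$ and the space $(\mathcal D_2)_p$ is the same for all $p\in M$ and all nonzero $X\in(\mathcal D_2)_p$. Let $\mathcal V$, $\mathcal H$ be the orthogonal projections of $TM$ onto $\ker F_*$ and $(\ker F_*)^\perp$, and $Q$ the orthogonal projection of $(\ker F_*)^\perp$ onto $\mathcal D_2$. Write $JU=\phi U+\omega U$ for $U\in\ker F_*$ and $JZ=BZ+CZ$ for $Z\in(\ker F_*)^\perp$,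 where $\phi U,BZ\in\ker F_*$ and $\omega U,CZ\in(\ker F_*)^\perp$, and put $\mathcal A_EG=\mathcal H\nabla_{\mathcal HE}\mathcal VG+\mathcal V\nabla_{\mathcal HE}\mathcal HG$ for vector fields $E,G$ on $M$. Let $\Gamma(\mathcal D_1)$ be the space of smooth vector fields on $M$ with values in $\mathcal D_1$. Then $\mathcal D_1$ defines a totally geodesic foliation (that is, $\mathcal D_1$ is involutive, $[X,Y]\in\Gamma(\mathcal D_1)$ for all $X,Y\in\Gamma(\mathcal D_1)$, and the second fundamental form of its leaves, the component of $\nabla_XY$ orthogonal to $\mathcal D_1$ for $X,Y\in\Gamma(\mathcal D_1)$, vanishes) if and only if, for all $X,Y\in\Gamma(\mathcal D_1)$, $$\phi\,\mathcal A_XJY+B\,\mathcal H\nabla_XJY=0\qquad\text{and}\qquad Q\bigl(\omega\,\mathcal A_XJY+C\,\mathcal H\nabla_XJY\bigr)=0 .$$ -/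

import Mathlib

open Bundle FiberBundle VectorField
open scoped Manifold ContDiff

namespace VSemiSlant

noncomputable section

section LeviCivita

set_option linter.unusedSectionVars false

variable {E : Type*} [NormedAddCommGroup E] [NormedSpace ℝ E] [FiniteDimensional ℝ E]
  {M : Type*} [TopologicalSpace M] [ChartedSpace E M] [IsManifold 𝓘(ℝ, E) ∞ M]
  [RiemannianBundle (fun x : M ↦ TangentSpace 𝓘(ℝ, E) x)]
  [IsContMDiffRiemannianBundle 𝓘(ℝ, E) ∞ E (fun x : M ↦ TangentSpace 𝓘(ℝ, E) x)]

instance tangentSpace_finiteDimensional (x : M) :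
    FiniteDimensional ℝ (TangentSpace 𝓘(ℝ, E) x) :=
  inferInstanceAs (FiniteDimensional ℝ E)

instance tangentSpace_completeSpace (x : M) : CompleteSpace (TangentSpace 𝓘(ℝ, E) x) :=
  FiniteDimensional.complete ℝ _

/-- Half of the right-hand side of the Koszul formula,
`½ (X⟨Y, Z⟩ + Y⟨Z, X⟩ - Z⟨X, Y⟩ + ⟨[X, Y], Z⟩ - ⟨[X, Z], Y⟩ - ⟨[Y, Z], X⟩)`, at `x`. -/
def koszul (Y X Z : Π x : M, TangentSpace 𝓘(ℝ, E) x) (x : M) : ℝ :=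
  (1 / 2 : ℝ) *
    (d% (fun y ↦ inner ℝ (Y y) (Z y)) x (X x) + d% (fun y ↦ inner ℝ (Z y) (X y)) x (Y x)
      - d% (fun y ↦ inner ℝ (X y) (Y y)) x (Z x)
      + inner ℝ (mlieBracket 𝓘(ℝ, E) X Y x) (Z x) - inner ℝ (mlieBracket 𝓘(ℝ, E) X Z x) (Y x)
      - inner ℝ (mlieBracket 𝓘(ℝ, E) Y Z x) (X x))


theorem mdifferentiableAt_inner {X Y : Π x : M, TangentSpace 𝓘(ℝ, E) x} {x : M}
    (hX : MDiffAt (T% X) x) (hY : MDiffAt (T% Y) x) :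
    MDiffAt (fun y ↦ inner ℝ (X y) (Y y)) x :=
  MDifferentiableAt.inner_bundle (F := E) (E := fun x : M ↦ TangentSpace 𝓘(ℝ, E) x)
    (IB := 𝓘(ℝ, E)) (b := fun y : M ↦ y) hX hY

theorem koszul_tensorial_left {Y Z : Π x : M, TangentSpace 𝓘(ℝ, E) x} {x : M}
    (hY : MDiffAt (T% Y) x) (hZ : MDiffAt (T% Z) x) :
    TensorialAt 𝓘(ℝ, E) E (fun X ↦ koszul Y X Z x) x where
  smul {f X} hf hX := by
    have := mvfderiv_fun_mul hf (mdifferentiableAt_inner hX hY)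
    have := mvfderiv_fun_mul hf (mdifferentiableAt_inner hZ hX)
    simp [koszul, inner_smul_left, inner_smul_right, inner_add_left, *,
      mlieBracket_smul_left hf hX]
    rw [real_inner_comm (Z x) (X x)]
    ring
  add {X X'} hX hX' := by
    have := mvfderiv_fun_add (mdifferentiableAt_inner hX hY) (mdifferentiableAt_inner hX' hY)
    have := mvfderiv_fun_add (mdifferentiableAt_inner hZ hX) (mdifferentiableAt_inner hZ hX')
    simp [koszul, inner_add_left, inner_add_right, *, mlieBracket_add_left hX hX']
    ring

theorem koszul_tensorial_right {Y X : Π x : M, TangentSpace 𝓘(ℝ, E) x} {x : M}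
    (hY : MDiffAt (T% Y) x) (hX : MDiffAt (T% X) x) :
    TensorialAt 𝓘(ℝ, E) E (fun Z ↦ koszul Y X Z x) x where
  smul {f Z} hf hZ := by
    have := mvfderiv_fun_mul hf (mdifferentiableAt_inner hZ hX)
    have := mvfderiv_fun_mul hf (mdifferentiableAt_inner hY hZ)
    simp [koszul, inner_smul_left, inner_smul_right, inner_add_left, *,
      mlieBracket_smul_right hf hZ]
    rw [real_inner_comm (Y x) (Z x)]
    ring
  add {Z Z'} hZ hZ' := by
    have := mvfderiv_fun_add (mdifferentiableAt_inner hZ hX) (mdifferentiableAt_inner hZ' hX)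
    have := mvfderiv_fun_add (mdifferentiableAt_inner hY hZ) (mdifferentiableAt_inner hY hZ')
    simp [koszul, inner_add_left, inner_add_right, *, mlieBracket_add_right hZ hZ']
    ring

open scoped Classical in
/-- For `Y` differentiable at `x`, the Koszul expression as a bilinear form in the values `X x` and
`Z x` (it is tensorial in `X` and in `Z`). For `Y` not differentiable at `x` the value is `0`. -/
def koszulForm (Y : Π x : M, TangentSpace 𝓘(ℝ, E) x) (x : M) :
    TangentSpace 𝓘(ℝ, E) x →L[ℝ] TangentSpace 𝓘(ℝ, E) x →L[ℝ] ℝ :=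
  if hY : MDiffAt (T% Y) x then
    TensorialAt.mkHom₂ (fun X Z ↦ koszul Y X Z x) x
      (fun _ hZ ↦ koszul_tensorial_left hY hZ) (fun _ hX ↦ koszul_tensorial_right hY hX)
  else 0

theorem koszulForm_apply {Y X Z : Π x : M, TangentSpace 𝓘(ℝ, E) x} {x : M}
    (hY : MDiffAt (T% Y) x) (hX : MDiffAt (T% X) x) (hZ : MDiffAt (T% Z) x) :
    koszulForm Y x (X x) (Z x) = koszul Y X Z x := by
  rw [koszulForm, dif_pos hY]
  exact TensorialAt.mkHom₂_apply _ _ hX hZ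

/-- `v ↦ ∇_v Y`, the endomorphism of the tangent space at `x` that represents the Koszul form. -/
def leviCivitaFun (Y : Π x : M, TangentSpace 𝓘(ℝ, E) x) (x : M) :
    TangentSpace 𝓘(ℝ, E) x →L[ℝ] TangentSpace 𝓘(ℝ, E) x :=
  InnerProductSpace.continuousLinearMapOfBilin (𝕜 := ℝ) (koszulForm Y x)

theorem inner_leviCivitaFun {Y X Z : Π x : M, TangentSpace 𝓘(ℝ, E) x} {x : M}
    (hY : MDiffAt (T% Y) x) (hX : MDiffAt (T% X) x) (hZ : MDiffAt (T% Z) x) :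
    inner ℝ (leviCivitaFun Y x (X x)) (Z x) = koszul Y X Z x := by
  rw [← koszulForm_apply hY hX hZ]
  exact InnerProductSpace.continuousLinearMapOfBilin_apply _ _ _

theorem leviCivitaFun_ext {x : M} {T T' : TangentSpace 𝓘(ℝ, E) x →L[ℝ] TangentSpace 𝓘(ℝ, E) x}
    (h : ∀ X Z : Π x : M, TangentSpace 𝓘(ℝ, E) x, MDiffAt (T% X) x → MDiffAt (T% Z) x →
      inner ℝ (T (X x)) (Z x) = inner ℝ (T' (X x)) (Z x)) : T = T' := by
  ext v
  refine ext_inner_right ℝ fun w ↦ ?_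
  simpa using h (extend E v) (extend E w) (mdifferentiableAt_extend ..) (mdifferentiableAt_extend ..)

/-- The Levi-Civita connection of the Riemannian metric of `M`, constructed from the Koszul formula.
In Mathlib's argument order `(∇_X Y)(x)` is `leviCivita Y x (X x)`. -/
def leviCivita : CovariantDerivative 𝓘(ℝ, E) E (fun x : M ↦ TangentSpace 𝓘(ℝ, E) x) where
  toFun := leviCivitaFun
  isCovariantDerivativeOnUniv :=
    { add := by
        intro Y Y' x hY hY' _
        refine leviCivitaFun_ext fun X Z hX hZ ↦ ?_
        have := mvfderiv_fun_add (mdifferentiableAt_inner hY hZ) (mdifferentiableAt_inner hY' hZ)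
        have := mvfderiv_fun_add (mdifferentiableAt_inner hX hY) (mdifferentiableAt_inner hX hY')
        rw [add_apply, inner_add_left, inner_leviCivitaFun hY hX hZ,
          inner_leviCivitaFun hY' hX hZ,
          inner_leviCivitaFun (mdifferentiableAt_add_section hY hY') hX hZ]
        simp [koszul, inner_add_left, inner_add_right, *, mlieBracket_add_left hY hY',
          mlieBracket_add_right hY hY']
        ring
      leibniz := by
        intro Y f x hY hf _
        refine leviCivitaFun_ext fun X Z hX hZ ↦ ?_
        have := mvfderiv_fun_mul hf (mdifferentiableAt_inner hY hZ)
        have := mvfderiv_fun_mul hf (mdifferentiableAt_inner hX hY)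
        rw [add_apply, inner_add_left, smul_apply,
          inner_smul_left, inner_leviCivitaFun hY hX hZ,
          inner_leviCivitaFun (hf.smul_section hY) hX hZ]
        simp [koszul, inner_add_left, inner_smul_left, inner_smul_right, *,
          mlieBracket_smul_left hf hY, mlieBracket_smul_right hf hY]
        rw [real_inner_comm (X x) (Y x)]
        ring }

/-- The connection is metric: `X⟨Y, Z⟩ = ⟨∇_X Y, Z⟩ + ⟨Y, ∇_X Z⟩`. -/
theorem leviCivita_metric {X Y Z : Π x : M, TangentSpace 𝓘(ℝ, E) x} {x : M}
    (hX : MDiffAt (T% X) x) (hY : MDiffAt (T% Y) x) (hZ : MDiffAt (T% Z) x) :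
    d% (fun y ↦ inner ℝ (Y y) (Z y)) x (X x) =
      inner ℝ (leviCivita Y x (X x)) (Z x) + inner ℝ (Y x) (leviCivita Z x (X x)) := by
  change _ = inner ℝ (leviCivitaFun Y x (X x)) (Z x) + inner ℝ (Y x) (leviCivitaFun Z x (X x))
  rw [real_inner_comm _ (Y x), inner_leviCivitaFun hY hX hZ, inner_leviCivitaFun hZ hX hY]
  have e (A B : Π x : M, TangentSpace 𝓘(ℝ, E) x) :
      (fun y ↦ inner ℝ (A y) (B y)) = fun y ↦ inner ℝ (B y) (A y) :=
    funext fun y ↦ real_inner_comm _ _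
  simp only [koszul, e Z Y, e Y X, e X Z, mlieBracket_swap_apply (V := Z) (W := Y),
    inner_neg_left]
  ring

/-- The connection is torsion-free. -/
theorem leviCivita_torsion : (leviCivita (E := E) (M := M)).torsion = 0 := by
  rw [CovariantDerivative.torsion_eq_zero_iff]
  intro X Y x hX hY
  refine ext_inner_right ℝ fun w ↦ ?_
  have hZ : MDiffAt (T% (extend E w)) x := mdifferentiableAt_extend ..
  have h1 := inner_leviCivitaFun hY hX hZ
  have h2 := inner_leviCivitaFun hX hY hZ
  have e (A B : Π x : M, TangentSpace 𝓘(ℝ, E) x) :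
      (fun y ↦ inner ℝ (A y) (B y)) = fun y ↦ inner ℝ (B y) (A y) :=
    funext fun y ↦ real_inner_comm _ _
  simp only [koszul, extend_apply_self] at h1 h2
  change inner ℝ (leviCivitaFun Y x (X x) - leviCivitaFun X x (Y x)) w = _
  rw [inner_sub_left, h1, h2, e Y X, e X (extend E w), e Y (extend E w),
    mlieBracket_swap_apply (V := Y) (W := X), inner_neg_left]
  ring

end LeviCivita
section Manifold

variable {E : Type*} [NormedAddCommGroup E] [NormedSpace ℝ E] [FiniteDimensional ℝ E]
  {M : Type*} [TopologicalSpace M] [ChartedSpace E M] [IsManifold 𝓘(ℝ, E) ∞ M]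
  [RiemannianBundle (fun x : M ↦ TangentSpace 𝓘(ℝ, E) x)]

/-- `(M, g, J)` is almost Hermitian: `J` is a smooth field of endomorphisms of the tangent spaces,
`J² = -id` and `g(JX, JY) = g(X, Y)`. -/
structure IsAlmostHermitian
    (J : Π x : M, TangentSpace 𝓘(ℝ, E) x →L[ℝ] TangentSpace 𝓘(ℝ, E) x) : Prop where
  smooth : ContMDiff 𝓘(ℝ, E) (𝓘(ℝ, E).prod 𝓘(ℝ, E →L[ℝ] E)) ∞
    (fun x ↦ TotalSpace.mk' (E →L[ℝ] E)
      (E := fun x : M ↦ TangentSpace 𝓘(ℝ, E) x →L[ℝ] TangentSpace 𝓘(ℝ, E) x) x (J x))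
  map_map (x : M) (v : TangentSpace 𝓘(ℝ, E) x) : J x (J x v) = -v
  inner_map_map (x : M) (v w : TangentSpace 𝓘(ℝ, E) x) :
    inner ℝ (J x v) (J x w) = inner ℝ v w

/-- `(M, g, J)` is Kähler: it is almost Hermitian and `∇J = 0`, that is,
`∇_X (JY) = J (∇_X Y)` for all smooth vector fields `X` and `Y`. -/
structure IsKahler [IsContMDiffRiemannianBundle 𝓘(ℝ, E) ∞ E (fun x : M ↦ TangentSpace 𝓘(ℝ, E) x)]
    (J : Π x : M, TangentSpace 𝓘(ℝ, E) x →L[ℝ] TangentSpace 𝓘(ℝ, E) x) : Prop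
    extends IsAlmostHermitian J where
  parallel (X Y : Π x : M, TangentSpace 𝓘(ℝ, E) x) (hX : CMDiff ∞ (T% X)) (hY : CMDiff ∞ (T% Y))
    (x : M) : leviCivita (fun y ↦ J y (Y y)) x (X x) = J x (leviCivita Y x (X x))

/-- A smooth distribution (subbundle of the tangent bundle): a field of subspaces of the tangent
spaces which near each point is spanned by finitely many smooth vector fields that are linearly
independent at every point. -/
def IsSmoothDistribution (D : Π x : M, Submodule ℝ (TangentSpace 𝓘(ℝ, E) x)) : Prop :=
  ∀ x₀ : M, ∃ U : Set M, IsOpen U ∧ x₀ ∈ U ∧ ∃ (k : ℕ)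
    (X : Fin k → Π x : M, TangentSpace 𝓘(ℝ, E) x), (∀ i, CMDiff[U] ∞ (T% (X i))) ∧
      ∀ x ∈ U, LinearIndependent ℝ (fun i ↦ X i x) ∧
        Submodule.span ℝ (Set.range fun i ↦ X i x) = D x

/-- `Γ(D)`: the smooth vector fields on `M` with values in `D`. -/
def sections (D : Π x : M, Submodule ℝ (TangentSpace 𝓘(ℝ, E) x)) :
    Set (Π x : M, TangentSpace 𝓘(ℝ, E) x) :=
  {X | CMDiff ∞ (T% X) ∧ ∀ x, X x ∈ D x}

/-- `D` is involutive: `[X, Y] ∈ Γ(D)` for `X, Y ∈ Γ(D)`. By the Frobenius theorem this is the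
integrability of `D`, i.e. `D` is tangent to a foliation of `M`. -/
def IsInvolutive (D : Π x : M, Submodule ℝ (TangentSpace 𝓘(ℝ, E) x)) : Prop :=
  ∀ X ∈ sections D, ∀ Y ∈ sections D, ∀ x, mlieBracket 𝓘(ℝ, E) X Y x ∈ D x

/-- The component of `∇_X Y` orthogonal to `D`. For `X, Y ∈ Γ(D)`, `D` involutive, this is the
second fundamental form of the leaves of `D`. -/
def secondFundamentalForm
    [IsContMDiffRiemannianBundle 𝓘(ℝ, E) ∞ E (fun x : M ↦ TangentSpace 𝓘(ℝ, E) x)]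
    (D : Π x : M, Submodule ℝ (TangentSpace 𝓘(ℝ, E) x))
    (X Y : Π x : M, TangentSpace 𝓘(ℝ, E) x) (x : M) : TangentSpace 𝓘(ℝ, E) x :=
  (D x)ᗮ.starProjection (leviCivita Y x (X x))

/-- `D` defines a totally geodesic foliation: `D` is involutive, and the leaves are totally geodesic
submanifolds, i.e. their second fundamental form vanishes. -/
structure DefinesTotallyGeodesicFoliation
    [IsContMDiffRiemannianBundle 𝓘(ℝ, E) ∞ E (fun x : M ↦ TangentSpace 𝓘(ℝ, E) x)]
    (D : Π x : M, Submodule ℝ (TangentSpace 𝓘(ℝ, E) x)) : Prop where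
  involutive : IsInvolutive D
  totallyGeodesic : ∀ X ∈ sections D, ∀ Y ∈ sections D, ∀ x, secondFundamentalForm D X Y x = 0

/-- The angle between a vector `v` and a subspace `K`: the angle between `v` and its orthogonal
projection to `K` (by Mathlib's convention `π / 2` if that projection is `0`). -/
def angleSubspace {x : M} (v : TangentSpace 𝓘(ℝ, E) x)
    (K : Submodule ℝ (TangentSpace 𝓘(ℝ, E) x)) : ℝ :=
  InnerProductGeometry.angle v (K.starProjection v)

end Manifold

section Submersion

variable (E : Type*) [NormedAddCommGroup E] [NormedSpace ℝ E] [FiniteDimensional ℝ E]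
  (E' : Type*) [NormedAddCommGroup E'] [NormedSpace ℝ E']
  {M : Type*} [TopologicalSpace M] [ChartedSpace E M] [IsManifold 𝓘(ℝ, E) ∞ M]
  [RiemannianBundle (fun x : M ↦ TangentSpace 𝓘(ℝ, E) x)]
  {N : Type*} [TopologicalSpace N] [ChartedSpace E' N] [IsManifold 𝓘(ℝ, E') ∞ N]

/-- The vertical space `ker F_*` at `x`. -/
def vertical (F : M → N) (x : M) : Submodule ℝ (TangentSpace 𝓘(ℝ, E) x) :=
  LinearMap.ker (mfderiv 𝓘(ℝ, E) 𝓘(ℝ, E') F x).toLinearMap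

/-- The horizontal space `(ker F_*)^⊥` at `x`. -/
def horizontal (F : M → N) (x : M) : Submodule ℝ (TangentSpace 𝓘(ℝ, E) x) :=
  (vertical E E' F x)ᗮ

/-- The slant distribution `D₂`: the orthogonal complement of `D₁` in `(ker F_*)^⊥`. -/
def slantPart (F : M → N) (D₁ : Π x : M, Submodule ℝ (TangentSpace 𝓘(ℝ, E) x)) (x : M) :
    Submodule ℝ (TangentSpace 𝓘(ℝ, E) x) :=
  horizontal E E' F x ⊓ (D₁ x)ᗮ

/-- `𝒱`, the projection to the vertical space. -/
def vert (F : M → N) (x : M) : TangentSpace 𝓘(ℝ, E) x →L[ℝ] TangentSpace 𝓘(ℝ, E) x :=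
  (vertical E E' F x).starProjection

/-- `ℋ`, the projection to the horizontal space. -/
def hor (F : M → N) (x : M) : TangentSpace 𝓘(ℝ, E) x →L[ℝ] TangentSpace 𝓘(ℝ, E) x :=
  (horizontal E E' F x).starProjection

/-- `Q`, the projection to `D₂`. -/
def projSlant (F : M → N) (D₁ : Π x : M, Submodule ℝ (TangentSpace 𝓘(ℝ, E) x)) (x : M) :
    TangentSpace 𝓘(ℝ, E) x →L[ℝ] TangentSpace 𝓘(ℝ, E) x :=
  (slantPart E E' F D₁ x).starProjection

variable (J : Π x : M, TangentSpace 𝓘(ℝ, E) x →L[ℝ] TangentSpace 𝓘(ℝ, E) x)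

/-- `φ`: for vertical `U`, `φ U` is the vertical part of `JU` (`φ` is extended by `0` to
horizontal vectors). -/
def phi (F : M → N) (x : M) : TangentSpace 𝓘(ℝ, E) x →L[ℝ] TangentSpace 𝓘(ℝ, E) x :=
  vert E E' F x ∘L J x ∘L vert E E' F x

/-- `ω`: for vertical `U`, `ω U` is the horizontal part of `JU` (`ω` is extended by `0` to
horizontal vectors). -/
def omega (F : M → N) (x : M) : TangentSpace 𝓘(ℝ, E) x →L[ℝ] TangentSpace 𝓘(ℝ, E) x :=
  hor E E' F x ∘L J x ∘L vert E E' F x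

/-- `B`: for horizontal `Z`, `B Z` is the vertical part of `JZ` (`B` is extended by `0` to
vertical vectors). -/
def tensorB (F : M → N) (x : M) : TangentSpace 𝓘(ℝ, E) x →L[ℝ] TangentSpace 𝓘(ℝ, E) x :=
  vert E E' F x ∘L J x ∘L hor E E' F x

/-- `C`: for horizontal `Z`, `C Z` is the horizontal part of `JZ` (`C` is extended by `0` to
vertical vectors). -/
def tensorC (F : M → N) (x : M) : TangentSpace 𝓘(ℝ, E) x →L[ℝ] TangentSpace 𝓘(ℝ, E) x :=
  hor E E' F x ∘L J x ∘L hor E E' F x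

/-- O'Neill's tensor `A_X Y = ℋ ∇_{ℋX} 𝒱Y + 𝒱 ∇_{ℋX} ℋY`. -/
def tensorA [IsContMDiffRiemannianBundle 𝓘(ℝ, E) ∞ E (fun x : M ↦ TangentSpace 𝓘(ℝ, E) x)]
    (F : M → N) (X Y : Π x : M, TangentSpace 𝓘(ℝ, E) x) (x : M) : TangentSpace 𝓘(ℝ, E) x :=
  hor E E' F x (leviCivita (fun y ↦ vert E E' F y (Y y)) x (hor E E' F x (X x))) +
    vert E E' F x (leviCivita (fun y ↦ hor E E' F y (Y y)) x (hor E E' F x (X x)))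

variable [RiemannianBundle (fun y : N ↦ TangentSpace 𝓘(ℝ, E') y)]

/-- `F` is a Riemannian submersion from `M` onto `N`: a surjective smooth submersion whose
differential preserves the lengths of horizontal vectors. -/
structure IsRiemannianSubmersion (F : M → N) : Prop where
  smooth : ContMDiff 𝓘(ℝ, E) 𝓘(ℝ, E') ∞ F
  surjective : Function.Surjective F
  mfderiv_surjective (x : M) : Function.Surjective (mfderiv 𝓘(ℝ, E) 𝓘(ℝ, E') F x)
  norm_mfderiv (x : M) (v : TangentSpace 𝓘(ℝ, E) x) (hv : v ∈ horizontal E E' F x) :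
    ‖mfderiv 𝓘(ℝ, E) 𝓘(ℝ, E') F x v‖ = ‖v‖

/-- `F` is a v-semi-slant submersion, with distribution `D₁`: `F` is a Riemannian submersion, `D₁`
is a distribution contained in `(ker F_*)^⊥` with `J(D₁) = D₁`, and the angle between `JX` and `D₂`,
the orthogonal complement of `D₁` in `(ker F_*)^⊥`, is the same for all nonzero `X` in `D₂`. -/
structure IsVSemiSlantSubmersion (F : M → N)
    (D₁ : Π x : M, Submodule ℝ (TangentSpace 𝓘(ℝ, E) x)) : Prop
    extends IsRiemannianSubmersion E E' F where
  distribution : IsSmoothDistribution D₁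
  le_horizontal (x : M) : D₁ x ≤ horizontal E E' F x
  map_eq (x : M) : (D₁ x).map (J x).toLinearMap = D₁ x
  slant : ∃ θ : ℝ, ∀ (x : M) (v : TangentSpace 𝓘(ℝ, E) x), v ∈ slantPart E E' F D₁ x → v ≠ 0 →
    angleSubspace (J x v) (slantPart E E' F D₁ x) = θ

end Submersion

end

end VSemiSlant

namespace VSemiSlant

section

variable {E : Type*} [NormedAddCommGroup E] [NormedSpace ℝ E] [FiniteDimensional ℝ E]
  {M : Type*} [TopologicalSpace M] [ChartedSpace E M]
  [RiemannianBundle (fun x : M ↦ TangentSpace 𝓘(ℝ, E) x)]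

variable {E' : Type*} [NormedAddCommGroup E'] [NormedSpace ℝ E']
  {N : Type*} [TopologicalSpace N] [ChartedSpace E' N]

/-! Since `leviCivita` is torsion-free, involutivity of `D₁` comes for free once `∇_X Y` stays in
`D₁`. So the left-hand side says exactly that `∇_X Y ∈ D₁` for all `X, Y ∈ Γ(D₁)`
(`definesTotallyGeodesicFoliation_iff`). Put `W = ∇_X JY`. The Kähler condition gives `W = J ∇_X Y`,
hence `JW = -∇_X Y`. As `X` and `JY` are horizontal, `A_X JY = 𝒱W` (`tensorA_of_horizontal`), and
the two expressions on the right-hand side regroup to `𝒱JW = -𝒱∇_X Y` and `QℋJW = -Qℋ∇_X Y`. In the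
orthogonal splitting `ker F_* ⊕ D₁ ⊕ D₂` their joint vanishing leaves only the `D₁` component of
`∇_X Y` (`vert_eq_zero_and_projSlant_hor_eq_zero_iff`). The equivalence holds separately for each
`X`, `Y` and each point. -/

theorem vert_add_hor (F : M → N) (x : M) (v : TangentSpace 𝓘(ℝ, E) x) :
    vert E E' F x v + hor E E' F x v = v :=
  Submodule.starProjection_add_starProjection_orthogonal v

theorem vert_vert (F : M → N) (x : M) (v : TangentSpace 𝓘(ℝ, E) x) :
    vert E E' F x (vert E E' F x v) = vert E E' F x v :=
  Submodule.starProjection_eq_self_iff.2 (Submodule.starProjection_apply_mem _ v)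

theorem hor_hor (F : M → N) (x : M) (v : TangentSpace 𝓘(ℝ, E) x) :
    hor E E' F x (hor E E' F x v) = hor E E' F x v :=
  Submodule.starProjection_eq_self_iff.2 (Submodule.starProjection_apply_mem _ v)

theorem hor_of_mem {F : M → N} {x : M} {v : TangentSpace 𝓘(ℝ, E) x}
    (hv : v ∈ horizontal E E' F x) : hor E E' F x v = v :=
  Submodule.starProjection_eq_self_iff.2 hv

theorem vert_of_mem {F : M → N} {x : M} {v : TangentSpace 𝓘(ℝ, E) x}
    (hv : v ∈ horizontal E E' F x) : vert E E' F x v = 0 :=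
  (Submodule.starProjection_apply_eq_zero_iff _).2 hv

/-- `φ` and `B` are `𝒱J` precomposed with the two complementary projections, so on the parts of one
vector they add up to `𝒱J`. This and its analogue for `ω` and `C` recover `J ∇_X JY` from its four
pieces. -/
theorem phi_vert_add_tensorB_hor (J : Π x : M, TangentSpace 𝓘(ℝ, E) x →L[ℝ] TangentSpace 𝓘(ℝ, E) x)
    (F : M → N) (x : M) (v : TangentSpace 𝓘(ℝ, E) x) :
    phi E E' J F x (vert E E' F x v) + tensorB E E' J F x (hor E E' F x v) =
      vert E E' F x (J x v) := by
  simp only [phi, tensorB, ContinuousLinearMap.comp_apply, vert_vert, hor_hor]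
  rw [← map_add, ← map_add, vert_add_hor]

theorem omega_vert_add_tensorC_hor
    (J : Π x : M, TangentSpace 𝓘(ℝ, E) x →L[ℝ] TangentSpace 𝓘(ℝ, E) x)
    (F : M → N) (x : M) (v : TangentSpace 𝓘(ℝ, E) x) :
    omega E E' J F x (vert E E' F x v) + tensorC E E' J F x (hor E E' F x v) =
      hor E E' F x (J x v) := by
  simp only [omega, tensorC, ContinuousLinearMap.comp_apply, vert_vert, hor_hor]
  rw [← map_add, ← map_add, vert_add_hor]

/-- The orthogonal splitting `TM = ker F_* ⊕ D₁ ⊕ D₂`. -/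
theorem vert_eq_zero_and_projSlant_hor_eq_zero_iff {F : M → N}
    {D : Π x : M, Submodule ℝ (TangentSpace 𝓘(ℝ, E) x)} {x : M}
    (hD : D x ≤ horizontal E E' F x) (v : TangentSpace 𝓘(ℝ, E) x) :
    vert E E' F x v = 0 ∧ projSlant E E' F D x (hor E E' F x v) = 0 ↔ v ∈ D x := by
  constructor
  · rintro ⟨h1, h2⟩
    have hv : v ∈ horizontal E E' F x := (Submodule.starProjection_apply_eq_zero_iff _).1 h1
    rw [hor_of_mem hv] at h2
    have h2 : v ∈ (slantPart E E' F D x)ᗮ := (Submodule.starProjection_apply_eq_zero_iff _).1 h2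
    -- The remainder `v - p` is horizontal and orthogonal to `D x`, so it lies in `D₂`. It is then
    -- orthogonal to `v` by `h2` and to `p` by projection, hence to itself.
    set p := (D x).starProjection v
    have hp : p ∈ D x := Submodule.starProjection_apply_mem _ v
    have hq : v - p ∈ (D x)ᗮ := Submodule.sub_starProjection_mem_orthogonal v
    have hs : v - p ∈ slantPart E E' F D x := ⟨sub_mem hv (hD hp), hq⟩
    have h3 : inner ℝ (v - p) v = 0 := h2 _ hs
    have h4 : inner ℝ (v - p) p = 0 := Submodule.inner_left_of_mem_orthogonal hp hq
    have h5 : v - p = 0 := by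
      rw [← inner_self_eq_zero (𝕜 := ℝ), inner_sub_right, h3, h4, sub_zero]
    rwa [sub_eq_zero.1 h5]
  · intro hv
    rw [hor_of_mem (hD hv)]
    refine ⟨vert_of_mem (hD hv), (Submodule.starProjection_apply_eq_zero_iff _).2 ?_⟩
    exact fun w hw ↦ Submodule.inner_left_of_mem_orthogonal hv hw.2

variable [IsManifold 𝓘(ℝ, E) ∞ M]
  [IsContMDiffRiemannianBundle 𝓘(ℝ, E) ∞ E (fun x : M ↦ TangentSpace 𝓘(ℝ, E) x)]

/-- For horizontal `X` and `Y`, O'Neill's tensor is `A_X Y = 𝒱 ∇_X Y`. -/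
theorem tensorA_of_horizontal {F : M → N} {X Y : Π x : M, TangentSpace 𝓘(ℝ, E) x} {x : M}
    (hX : X x ∈ horizontal E E' F x) (hY : ∀ y, Y y ∈ horizontal E E' F y) :
    tensorA E E' F X Y x = vert E E' F x (leviCivita Y x (X x)) := by
  -- `Y` is differentiated, so its vertical part must vanish as a field and not only at `x`; `X`
  -- enters through its value at `x` alone.
  have h1 : (fun y ↦ vert E E' F y (Y y)) = 0 := funext fun y ↦ vert_of_mem (hY y)
  have h2 : (fun y ↦ hor E E' F y (Y y)) = Y := funext fun y ↦ hor_of_mem (hY y)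
  rw [tensorA, hor_of_mem hX, h1, h2, CovariantDerivative.zero]
  simp

/-- By torsion-freeness, a distribution preserved by the Levi-Civita connection along its own
sections is involutive; so it is totally geodesic as soon as `∇_X Y` stays in it. -/
theorem definesTotallyGeodesicFoliation_iff (D : Π x : M, Submodule ℝ (TangentSpace 𝓘(ℝ, E) x)) :
    DefinesTotallyGeodesicFoliation D ↔
      ∀ X ∈ sections D, ∀ Y ∈ sections D, ∀ x, leviCivita Y x (X x) ∈ D x := by
  have key (X Y : Π x : M, TangentSpace 𝓘(ℝ, E) x) (x : M) :
      secondFundamentalForm D X Y x = 0 ↔ leviCivita Y x (X x) ∈ D x := by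
    -- The projection to `Dᗮ` kills exactly `Dᗮᗮ`, which is `D` because tangent spaces are
    -- finite-dimensional.
    rw [secondFundamentalForm, Submodule.starProjection_apply_eq_zero_iff,
      Submodule.orthogonal_orthogonal]
  refine ⟨fun h X hX Y hY x ↦ (key X Y x).1 (h.totallyGeodesic X hX Y hY x),
    fun h ↦ ⟨fun X hX Y hY x ↦ ?_, fun X hX Y hY x ↦ (key X Y x).2 (h X hX Y hY x)⟩⟩
  have hXd : MDiffAt (T% X) x := hX.1.mdifferentiable (by simp) x
  have hYd : MDiffAt (T% Y) x := hY.1.mdifferentiable (by simp) x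
  -- Here `[X, Y] = ∇_X Y - ∇_Y X`, and both terms lie in `D` by `h`.
  rw [← (CovariantDerivative.torsion_eq_zero_iff _).1 leviCivita_torsion hXd hYd]
  exact sub_mem (h X hX Y hY x) (h Y hY X hX x)

end

end VSemiSlant

theorem proposition3p13
    {E : Type*} [NormedAddCommGroup E] [NormedSpace ℝ E] [FiniteDimensional ℝ E]
    {E' : Type*} [NormedAddCommGroup E'] [NormedSpace ℝ E'] [FiniteDimensional ℝ E']
    {M : Type*} [TopologicalSpace M] [T2Space M] [SecondCountableTopology M]
    [ChartedSpace E M] [IsManifold 𝓘(ℝ, E) ∞ M]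
    [RiemannianBundle (fun x : M ↦ TangentSpace 𝓘(ℝ, E) x)]
    [IsContMDiffRiemannianBundle 𝓘(ℝ, E) ∞ E (fun x : M ↦ TangentSpace 𝓘(ℝ, E) x)]
    {N : Type*} [TopologicalSpace N] [T2Space N] [SecondCountableTopology N]
    [ChartedSpace E' N] [IsManifold 𝓘(ℝ, E') ∞ N]
    [RiemannianBundle (fun y : N ↦ TangentSpace 𝓘(ℝ, E') y)]
    [IsContMDiffRiemannianBundle 𝓘(ℝ, E') ∞ E' (fun y : N ↦ TangentSpace 𝓘(ℝ, E') y)]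
    (J : Π x : M, TangentSpace 𝓘(ℝ, E) x →L[ℝ] TangentSpace 𝓘(ℝ, E) x)
    (hJ : VSemiSlant.IsKahler J)
    (F : M → N) (D₁ : Π x : M, Submodule ℝ (TangentSpace 𝓘(ℝ, E) x))
    (hF : VSemiSlant.IsVSemiSlantSubmersion E E' J F D₁) :
    VSemiSlant.DefinesTotallyGeodesicFoliation D₁ ↔
      ∀ X ∈ VSemiSlant.sections D₁, ∀ Y ∈ VSemiSlant.sections D₁, ∀ x : M,
        VSemiSlant.phi E E' J F x (VSemiSlant.tensorA E E' F X (fun y ↦ J y (Y y)) x) +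
            VSemiSlant.tensorB E E' J F x
              (VSemiSlant.hor E E' F x
                (VSemiSlant.leviCivita (fun y ↦ J y (Y y)) x (X x))) = 0 ∧
        VSemiSlant.projSlant E E' F D₁ x
          (VSemiSlant.omega E E' J F x (VSemiSlant.tensorA E E' F X (fun y ↦ J y (Y y)) x) +
            VSemiSlant.tensorC E E' J F x
              (VSemiSlant.hor E E' F x
                (VSemiSlant.leviCivita (fun y ↦ J y (Y y)) x (X x)))) = 0 := by
  rw [VSemiSlant.definesTotallyGeodesicFoliation_iff]
  refine forall₄_congr fun X hX Y hY ↦ forall_congr' fun x ↦ ?_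
  -- Only the inclusion `J(D₁) ⊆ D₁` of `map_eq` matters here.
  have hJY (y : M) : J y (Y y) ∈ VSemiSlant.horizontal E E' F y :=
    hF.le_horizontal y (hF.map_eq y ▸ Submodule.mem_map_of_mem (hY.2 y))
  -- After regrouping, both conditions concern `J ∇_X JY = J² ∇_X Y = -∇_X Y`; the sign is harmless
  -- for membership in a subspace.
  rw [VSemiSlant.tensorA_of_horizontal (hF.le_horizontal x (hX.2 x)) hJY,
    VSemiSlant.phi_vert_add_tensorB_hor, VSemiSlant.omega_vert_add_tensorC_hor,
    hJ.parallel X Y hX.1 hY.1 x, hJ.map_map,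
    VSemiSlant.vert_eq_zero_and_projSlant_hor_eq_zero_iff (hF.le_horizontal x), neg_mem_iff]
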